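/- All graphs are finite and simple. A graph $H$ is a minor of a graph $G$ if a graph isomorphic to $H$ can be obtained from $G$ by repeatedly deleting vertices, deleting edges and contracting edges. For a real number $m$, a graph $G$ is called $m$-minor-universal if every graph with at most $m$ edges and with no isolated vertices is a minor of $G$. Let $Q_d$ denote the $d$-dimensional hypercube graph: its vertex set is $\mathbb{Z}_2^d$, and two vertices are adjacent if and only if their Hamming distance is $1$. There is an absolute constant $c>0$ such that for every integer $d\ge 1$ the hypercube $Q_d$ is $c\,\frac{2^d}{d}$-minor-universal. Moreover, there is an absolute constant $C>0$ such that for every integer $d\ge 1$ the hypercube $Q_d$ is not $\frac{C\,2^d}{\sqrt d}$-minor-universal. -/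

import Mathlib

namespace SimpleGraph

/-- Contraction of the edge `uv` of `G`: the vertices `u` and `v` are replaced by one new vertex
(`none`), which is adjacent to all the other neighbours of `u` and of `v`. -/
def contractEdge {V : Type*} (G : SimpleGraph V) (u v : V) :
    SimpleGraph (Option {x : V // x ≠ u ∧ x ≠ v}) where
  Adj a b :=
    match a, b with
    | none, none => False
    | none, some y => G.Adj u y ∨ G.Adj v y
    | some x, none => G.Adj u x ∨ G.Adj v x
    | some x, some y => G.Adj x y
  symm := ⟨by
    rintro (_ | x) (_ | y) h
    · exact h
    · exact h
    · exact h
    · exact G.adj_symm h⟩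
  loopless := ⟨by
    rintro (_ | x) h
    · exact h
    · exact G.irrefl h⟩

/-- `H.IsMinor G`: a graph isomorphic to `H` can be obtained from `G` by repeatedly deleting
vertices, deleting edges and contracting edges. -/
inductive IsMinor.{u, v} {W : Type u} (H : SimpleGraph W) : ∀ {V : Type v}, SimpleGraph V → Prop
  | iso {V : Type v} {G : SimpleGraph V} (e : G ≃g H) : IsMinor H G
  | deleteVertex {V : Type v} {G : SimpleGraph V} (v : V)
      (h : IsMinor H (G.induce {x | x ≠ v})) : IsMinor H G
  | deleteEdge {V : Type v} {G : SimpleGraph V} (e : Sym2 V) (he : e ∈ G.edgeSet)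
      (h : IsMinor H (G.deleteEdges {e})) : IsMinor H G
  | contract {V : Type v} {G : SimpleGraph V} (u v : V) (huv : G.Adj u v)
      (h : IsMinor H (G.contractEdge u v)) : IsMinor H G

/-- `G` is `m`-minor-universal: every finite graph with at most `m` edges and with no isolated
vertices is a minor of `G`. -/
def IsMinorUniversal {V : Type*} (G : SimpleGraph V) (m : ℝ) : Prop :=
  ∀ (W : Type) [Finite W] (H : SimpleGraph W),
    (∀ w, ¬ H.IsIsolated w) → (H.edgeSet.ncard : ℝ) ≤ m → H.IsMinor G

/-- The `d`-dimensional hypercube graph: the vertices are the elements of `(ZMod 2) ^ d`, two of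
them being adjacent when their Hamming distance is `1`. -/
def hypercube (d : ℕ) : SimpleGraph (Fin d → ZMod 2) where
  Adj x y := hammingDist x y = 1
  symm := ⟨fun x y h => (hammingDist_comm y x).trans h⟩
  loopless := ⟨fun x h => by simp at h⟩

end SimpleGraph

/-!
Upper bound. Let `s` be the size of the middle layer of `Q_d`, which is at most `2 ^ d / √d`. By
counting, some graph on `4 * s` vertices with `O(s)` edges has an edge between any two disjoint sets
of `s` vertices. Each layer of `Q_d` separates the vertices above it from those below it, so in a
model of this graph fewer than `s` branch sets lie entirely on one of the two sides; moving from one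
layer to the next, the majority of the branch sets would have to jump across.

Lower bound. A permutation of the vertices of `Q_k` is a product of `2 * k` permutations each of
which changes a single coordinate (the Beneš network). Performing them one after the other in
`O(k)` copies of `Q_k` gives disjoint connected routes from every `x` to `π x`, so a cube with
`O(k * 2 ^ k)` vertices has as a minor the union of `Q_k` and a copy of it permuted by `π`. List
the darts of `H`, grouped by their first vertices, along a Hamiltonian path of the first copy, and
let `π` send the two darts of each edge to neighbours in the second copy: contracting the groups
then produces `H`.
-/

namespace HypercubeMinor

open SimpleGraph Function

section Connectivity

variable {ι V V' : Type*} {K : SimpleGraph ι} {G : SimpleGraph V} {G' : SimpleGraph V'}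

lemma connected_induce_iUnion {C : ι → Set V} (hK : K.Connected)
    (hC : ∀ i, (G.induce (C i)).Connected)
    (hadj : ∀ i j, K.Adj i j → (G.induce (C i ∪ C j)).Connected) :
    (G.induce (⋃ i, C i)).Connected := by
  have reachable_of_subset {s : Set V} (hs : s ⊆ ⋃ i, C i) (hconn : (G.induce s).Connected)
      {x y : V} (hx : x ∈ s) (hy : y ∈ s) :
      (G.induce (⋃ i, C i)).Reachable ⟨x, hs hx⟩ ⟨y, hs hy⟩ :=
    (hconn ⟨x, hx⟩ ⟨y, hy⟩).map (G.induceHomOfLE hs).toHom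
  have reachable_of_walk {i j : ι} (p : K.Walk i j) : ∀ {x y : V} (hx : x ∈ C i) (hy : y ∈ C j),
      (G.induce (⋃ i, C i)).Reachable ⟨x, Set.mem_iUnion_of_mem i hx⟩
        ⟨y, Set.mem_iUnion_of_mem j hy⟩ := by
    induction p with
    | nil => exact fun hx hy => reachable_of_subset (Set.subset_iUnion C _) (hC _) hx hy
    | @cons i k j h _ ih =>
      intro x y hx hy
      obtain ⟨z, hz⟩ := (hC k).nonempty
      exact (reachable_of_subset (Set.union_subset (Set.subset_iUnion C i) (Set.subset_iUnion C k))
        (hadj i k h) (Or.inl hx) (Or.inr hz)).trans (ih hz hy)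
  obtain ⟨i⟩ := hK.nonempty
  obtain ⟨x, hx⟩ := (hC i).nonempty
  refine connected_iff_exists_forall_reachable _ |>.2 ⟨⟨x, Set.mem_iUnion_of_mem i hx⟩, ?_⟩
  rintro ⟨y, hy⟩
  obtain ⟨j, hyj⟩ := Set.mem_iUnion.1 hy
  exact reachable_of_walk (hK i j).some hx hyj

lemma connected_induce_image {f : V → V'} {s : Set V} (hs : (G.induce s).Connected)
    (hf : ∀ x y, G.Adj x y → f x = f y ∨ G'.Adj (f x) (f y)) :
    (G'.induce (f '' s)).Connected := by
  rw [Set.image_eq_iUnion, Set.biUnion_eq_iUnion]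
  refine connected_induce_iUnion hs (fun _ => .of_subsingleton) fun x y hxy => ?_
  rw [Set.singleton_union]
  obtain heq | hadj := hf x y hxy
  · rw [heq, Set.pair_eq_singleton]
    exact .of_subsingleton
  · exact induce_pair_connected_of_adj hadj

end Connectivity

section MinorModel

/-- Branch sets witnessing that `H` is a minor of `G`: pairwise disjoint connected vertex sets
`B w`, one for each vertex `w` of `H`, such that adjacent vertices of `H` have branch sets joined by
an edge of `G`. -/
structure IsMinorModel {V W : Type*} (H : SimpleGraph W) (G : SimpleGraph V) (B : W → Set V) :
    Prop where
  connected (w : W) : (G.induce (B w)).Connected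
  disjoint : Pairwise (Disjoint on B)
  exists_adj {w w' : W} : H.Adj w w' → ∃ x ∈ B w, ∃ y ∈ B w', G.Adj x y

variable {U V W : Type*} {F : SimpleGraph U} {G : SimpleGraph V} {H : SimpleGraph W}
  {B : W → Set V}

lemma IsMinorModel.nonempty (hB : IsMinorModel H G B) (w : W) : (B w).Nonempty :=
  Set.nonempty_coe_sort.1 (hB.connected w).nonempty

lemma IsMinorModel.eq_of_mem (hB : IsMinorModel H G B) {w w' : W} {x : V} (hx : x ∈ B w)
    (hx' : x ∈ B w') : w = w' :=
  hB.disjoint.eq (Set.not_disjoint_iff.2 ⟨x, hx, hx'⟩)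

lemma pairwise_disjoint_of_eq_of_mem (h : ∀ w w' x, x ∈ B w → x ∈ B w' → w = w') :
    Pairwise (Disjoint on B) :=
  fun w w' hne => Set.disjoint_left.2 fun x hx hx' => hne (h w w' x hx hx')

lemma IsMinorModel.trans {C : V → Set U} (hB : IsMinorModel H G B) (hC : IsMinorModel G F C) :
    IsMinorModel H F fun w => ⋃ v : B w, C v where
  connected w := connected_induce_iUnion (hB.connected w) (fun v => hC.connected v)
    fun v v' hvv' => by
      obtain ⟨x, hx, y, hy, hxy⟩ := hC.exists_adj hvv'
      exact connected_induce_union (hC.connected v).preconnected (hC.connected v').preconnected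
        hx hy hxy
  disjoint := pairwise_disjoint_of_eq_of_mem fun w w' x hx hx' => by
    obtain ⟨⟨v, hv⟩, hxv⟩ := Set.mem_iUnion.1 hx
    obtain ⟨⟨v', hv'⟩, hxv'⟩ := Set.mem_iUnion.1 hx'
    obtain rfl := hC.eq_of_mem hxv hxv'
    exact hB.eq_of_mem hv hv'
  exists_adj h := by
    obtain ⟨v, hv, v', hv', hvv'⟩ := hB.exists_adj h
    obtain ⟨x, hx, y, hy, hxy⟩ := hC.exists_adj hvv'
    exact ⟨x, Set.mem_iUnion_of_mem ⟨v, hv⟩ hx, y, Set.mem_iUnion_of_mem ⟨v', hv'⟩ hy, hxy⟩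

lemma isMinorModel_singleton (f : Copy H G) : IsMinorModel H G fun w => {f w} where
  connected _ := .of_subsingleton
  disjoint _ _ hne := Set.disjoint_singleton.2 (f.injective.ne hne)
  exists_adj h := ⟨_, rfl, _, rfl, f.toHom.map_adj h⟩

lemma IsMinorModel.preimage_val {s : Set V} (hB : IsMinorModel H G B) (hs : ∀ w, B w ⊆ s) :
    IsMinorModel H (G.induce s) fun w => Subtype.val ⁻¹' B w where
  connected w := (hB.connected w).map
    (⟨fun x => ⟨⟨x, hs w x.2⟩, x.2⟩, id⟩ :
      G.induce (B w) →g (G.induce s).induce (Subtype.val ⁻¹' B w))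
    fun x => ⟨⟨x, x.2⟩, rfl⟩
  disjoint _ _ hne := (hB.disjoint hne).preimage _
  exists_adj h := by
    obtain ⟨x, hx, y, hy, hxy⟩ := hB.exists_adj h
    exact ⟨⟨x, hs _ hx⟩, hx, ⟨y, hs _ hy⟩, hy, hxy⟩

end MinorModel

section ContractEdge

variable {V W : Type*} {u v : V} {G : SimpleGraph V} {H : SimpleGraph W} {B : W → Set V}

open Classical in
/-- The map from the vertices of `G` to those of `G.contractEdge u v` that merges `u` and `v`. -/
noncomputable def contractMap (u v x : V) : Option {x : V // x ≠ u ∧ x ≠ v} :=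
  if h : x ≠ u ∧ x ≠ v then some ⟨x, h⟩ else none

lemma contractMap_eq_none {x : V} : contractMap u v x = none ↔ x = u ∨ x = v := by
  simp only [contractMap, dite_eq_right_iff, reduceCtorEq, imp_false, not_and_or, not_not]

lemma contractMap_eq_some {x : V} {y : {x : V // x ≠ u ∧ x ≠ v}} :
    contractMap u v x = some y ↔ x = y := by
  refine ⟨fun h => ?_, fun h => ?_⟩
  · unfold contractMap at h
    split_ifs at h
    exact congrArg Subtype.val (Option.some.inj h)
  · subst h
    exact dif_pos y.2

lemma contractMap_eq_contractMap {x y : V} :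
    contractMap u v x = contractMap u v y ↔ x = y ∨ (x = u ∨ x = v) ∧ (y = u ∨ y = v) := by
  constructor
  · intro h
    cases hy : contractMap u v y with
    | none => exact Or.inr ⟨contractMap_eq_none.1 (h.trans hy), contractMap_eq_none.1 hy⟩
    | some z => exact Or.inl <|
        (contractMap_eq_some.1 (h.trans hy)).trans (contractMap_eq_some.1 hy).symm
  · rintro (rfl | ⟨hx, hy⟩)
    · rfl
    · rw [contractMap_eq_none.2 hx, contractMap_eq_none.2 hy]

lemma contractMap_surjective : Surjective (contractMap u v) := by
  rintro (_ | x)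
  · exact ⟨u, contractMap_eq_none.2 (Or.inl rfl)⟩
  · exact ⟨x, contractMap_eq_some.2 rfl⟩

lemma contractEdge_adj_iff {a b : Option {x : V // x ≠ u ∧ x ≠ v}} :
    (G.contractEdge u v).Adj a b ↔
      a ≠ b ∧ ∃ x y, contractMap u v x = a ∧ contractMap u v y = b ∧ G.Adj x y := by
  rcases a with _ | a <;> rcases b with _ | b <;>
    simp only [contractMap_eq_none, contractMap_eq_some, contractEdge]
  · simp
  · simp [or_and_right, exists_or]
  · simp [or_and_right, exists_or, G.adj_comm a.1]
  · simpa [Subtype.ext_iff] using fun h : G.Adj a b => h.ne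

lemma card_contractEdge_lt [Finite V] (huv : u ≠ v) :
    Nat.card (Option {x : V // x ≠ u ∧ x ≠ v}) < Nat.card V := by
  refine lt_of_not_ge fun hle => huv ?_
  have hinj : Injective (contractMap u v) :=
    (contractMap_surjective.bijective_of_nat_card_le hle).injective
  exact hinj (contractMap_eq_contractMap.2 (Or.inr ⟨Or.inl rfl, Or.inr rfl⟩))

lemma isMinorModel_contractEdge (huv : G.Adj u v) :
    IsMinorModel (G.contractEdge u v) G fun a => contractMap u v ⁻¹' {a} where
  connected a := by
    cases a with
    | none =>
      have hfibre : contractMap u v ⁻¹' {none} = {u, v} := Set.ext fun _ => contractMap_eq_none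
      rw [hfibre]
      exact induce_pair_connected_of_adj huv
    | some x =>
      have hfibre : contractMap u v ⁻¹' {some x} = {x.1} := Set.ext fun _ => contractMap_eq_some
      rw [hfibre]
      exact .of_subsingleton
  disjoint _ _ hne := (Set.disjoint_singleton.2 hne).preimage _
  exists_adj h := by
    obtain ⟨-, x, y, hx, hy, hxy⟩ := contractEdge_adj_iff.1 h
    exact ⟨x, hx, y, hy, hxy⟩

lemma IsMinorModel.image_contractMap (hB : IsMinorModel H G B) {w₀ : W} (hu : u ∈ B w₀)
    (hv : v ∈ B w₀) : IsMinorModel H (G.contractEdge u v) fun w => contractMap u v '' B w := by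
  have mem_of_eq {z : V} (hz : z = u ∨ z = v) : z ∈ B w₀ := by
    rcases hz with rfl | rfl <;> assumption
  have eq_of_contractMap_eq {w w' : W} {p q : V} (hp : p ∈ B w) (hq : q ∈ B w')
      (hpq : contractMap u v p = contractMap u v q) : w = w' := by
    obtain rfl | ⟨hp', hq'⟩ := contractMap_eq_contractMap.1 hpq
    · exact hB.eq_of_mem hp hq
    · exact (hB.eq_of_mem hp (mem_of_eq hp')).trans (hB.eq_of_mem (mem_of_eq hq') hq)
  refine ⟨fun w => connected_induce_image (hB.connected w) fun x y hxy => ?_,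
    pairwise_disjoint_of_eq_of_mem ?_, fun {w w'} h => ?_⟩
  · rw [or_iff_not_imp_left]
    exact fun hne => contractEdge_adj_iff.2 ⟨hne, x, y, rfl, rfl, hxy⟩
  · rintro w w' _ ⟨p, hp, rfl⟩ ⟨q, hq, hqp⟩
    exact eq_of_contractMap_eq hp hq hqp.symm
  · obtain ⟨p, hp, q, hq, hpq⟩ := hB.exists_adj h
    exact ⟨_, ⟨p, hp, rfl⟩, _, ⟨q, hq, rfl⟩, contractEdge_adj_iff.2
      ⟨fun heq => h.ne (eq_of_contractMap_eq hp hq heq), p, q, rfl, rfl, hpq⟩⟩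

end ContractEdge

section IsMinor

variable {V W : Type*} {G : SimpleGraph V} {H : SimpleGraph W} {B : W → Set V}

lemma exists_isMinorModel (h : H.IsMinor G) : ∃ B, IsMinorModel H G B := by
  induction h with
  | iso e => exact ⟨_, isMinorModel_singleton e.symm.toCopy⟩
  | deleteVertex v _ ih =>
    obtain ⟨B, hB⟩ := ih
    exact ⟨_, hB.trans (isMinorModel_singleton (Copy.induce _ _))⟩
  | deleteEdge e _ _ ih =>
    obtain ⟨B, hB⟩ := ih
    exact ⟨_, hB.trans (isMinorModel_singleton (.ofLE _ _ (deleteEdges_le _)))⟩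
  | contract u v huv _ ih =>
    obtain ⟨B, hB⟩ := ih
    exact ⟨_, hB.trans (isMinorModel_contractEdge huv)⟩

lemma isMinor_of_equiv [Finite V] (f : W ≃ V) (hf : ∀ w w', H.Adj w w' → G.Adj (f w) (f w')) :
    H.IsMinor G := by
  induction hn : G.edgeSet.ncard using Nat.strong_induction_on generalizing G with
  | _ n ih =>
    by_cases hG : ∃ w w', G.Adj (f w) (f w') ∧ ¬ H.Adj w w'
    · obtain ⟨w, w', hadj, hnot⟩ := hG
      refine .deleteEdge s(f w, f w') hadj (ih _ ?_ (fun a b hab => ?_) rfl)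
      · rw [← hn, edgeSet_deleteEdges]
        exact Set.ncard_sdiff_singleton_lt_of_mem hadj
      · refine deleteEdges_adj.2 ⟨hf a b hab, fun heq => hnot ?_⟩
        have hmap : s(a, b).map f = s(w, w').map f := heq
        rwa [← mem_edgeSet, ← Sym2.map.injective f.injective hmap]
    · push Not at hG
      exact .iso (Iso.symm ⟨f, fun {a b} => ⟨hG a b, hf a b⟩⟩)

lemma IsMinorModel.isMinor_of_subsingleton [Finite V] (hB : IsMinorModel H G B)
    (hcover : ∀ x, ∃ w, x ∈ B w) (hsub : ∀ w, (B w).Subsingleton) : H.IsMinor G := by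
  choose f hf using hB.nonempty
  have eq_apply {w : W} {x : V} (hx : x ∈ B w) : x = f w := hsub w hx (hf w)
  have hbij : Bijective f := by
    refine ⟨fun w w' h => hB.eq_of_mem (hf w) (h ▸ hf w'), fun x => ?_⟩
    obtain ⟨w, hw⟩ := hcover x
    exact ⟨w, (eq_apply hw).symm⟩
  refine isMinor_of_equiv (.ofBijective f hbij) fun w w' h => ?_
  obtain ⟨x, hx, y, hy, hxy⟩ := hB.exists_adj h
  rwa [eq_apply hx, eq_apply hy] at hxy

lemma IsMinorModel.isMinor [Finite V] (hB : IsMinorModel H G B) : H.IsMinor G := by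
  induction hn : Nat.card V using Nat.strong_induction_on generalizing V with
  | _ n ih =>
    by_cases hcover : ∀ x, ∃ w, x ∈ B w
    · by_cases hsub : ∀ w, (B w).Subsingleton
      · exact hB.isMinor_of_subsingleton hcover hsub
      · push Not at hsub
        obtain ⟨w, hw⟩ := hsub
        have : Nontrivial (B w) := Set.nontrivial_coe_sort.2 hw
        obtain ⟨⟨u, hu⟩⟩ := (hB.connected w).nonempty
        obtain ⟨⟨v, hv⟩, huv⟩ := (hB.connected w).preconnected.exists_adj_of_nontrivial ⟨u, hu⟩
        have huv : G.Adj u v := huv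
        exact .contract u v huv
          (ih _ (hn ▸ card_contractEdge_lt huv.ne) (hB.image_contractMap hu hv) rfl)
    · push Not at hcover
      obtain ⟨x, hx⟩ := hcover
      refine .deleteVertex x (ih _ ?_ (hB.preimage_val fun w y hy => ?_) rfl)
      · exact hn ▸ Finite.card_subtype_lt (x := x) (by simp)
      · exact ne_of_mem_of_not_mem hy (hx w)

end IsMinor

section Separator

variable {V W : Type*} {G : SimpleGraph V} {H : SimpleGraph W} {B : W → Set V} {S T : Set V}
  {s : ℕ}

/-- Any two disjoint sets of at least `s` vertices of `H` are joined by an edge. -/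
def IsJoined (H : SimpleGraph W) (s : ℕ) : Prop :=
  ∀ ⦃X Y : Set W⦄, Disjoint X Y → s ≤ X.ncard → s ≤ Y.ncard → ∃ x ∈ X, ∃ y ∈ Y, H.Adj x y

/-- The vertices whose branch sets lie inside `S`. -/
def branchesIn (B : W → Set V) (S : Set V) : Set W := {w | B w ⊆ S}

lemma IsMinorModel.branchesIn_empty (hB : IsMinorModel H G B) : branchesIn B ∅ = ∅ :=
  Set.eq_empty_of_forall_notMem fun w hw => (hB.nonempty w).not_subset_empty hw

lemma IsMinorModel.disjoint_branchesIn (hB : IsMinorModel H G B) (hST : Disjoint S T) :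
    Disjoint (branchesIn B S) (branchesIn B T) :=
  Set.disjoint_left.2 fun w hS hT =>
    (hB.nonempty w).not_subset_empty ((Set.subset_inter hS hT).trans hST.inter_eq.subset)

lemma IsMinorModel.subset_or_subset_of_subset_union (hB : IsMinorModel H G B)
    (hST : ∀ x ∈ S, ∀ y ∈ T, ¬ G.Adj x y) {w : W} (hw : B w ⊆ S ∪ T) : B w ⊆ S ∨ B w ⊆ T := by
  by_contra! h
  obtain ⟨⟨x, hx, hxS⟩, ⟨y, hy, hyT⟩⟩ := Set.not_subset.1 h.1, Set.not_subset.1 h.2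
  have hyS := (hw hy).resolve_right hyT
  obtain ⟨p⟩ := hB.connected w ⟨y, hy⟩ ⟨x, hx⟩
  obtain ⟨e, -, he, he'⟩ := p.exists_boundary_dart (Subtype.val ⁻¹' S) hyS hxS
  exact hST _ he _ ((hw e.snd.2).resolve_left he') e.adj

lemma IsMinorModel.card_le_of_separator [Finite V] [Finite W] (hB : IsMinorModel H G B)
    (hST : ∀ x ∈ S, ∀ y ∈ T, ¬ G.Adj x y) :
    Nat.card W ≤ (branchesIn B S).ncard + (branchesIn B T).ncard + (S ∪ T)ᶜ.ncard := by
  have hmeet : ∀ w, ∃ x ∈ B w, w ∉ branchesIn B S ∪ branchesIn B T → x ∉ S ∪ T := by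
    intro w
    by_contra! h
    obtain ⟨x, hx⟩ := hB.nonempty w
    exact (h x hx).1 (hB.subset_or_subset_of_subset_union hST fun y hy => (h y hy).2)
  choose f hfB hf using hmeet
  have hcompl : (branchesIn B S ∪ branchesIn B T)ᶜ.ncard ≤ (S ∪ T)ᶜ.ncard :=
    Set.ncard_le_ncard_of_injOn f hf fun w _ w' _ h => hB.eq_of_mem (hfB w) (h ▸ hfB w')
  have hunion := Set.ncard_union_le (branchesIn B S) (branchesIn B T)
  have hcard := Set.ncard_add_ncard_compl (branchesIn B S ∪ branchesIn B T)
  omega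

lemma IsMinorModel.ncard_branchesIn_lt_or (hB : IsMinorModel H G B) (hH : IsJoined H s)
    (hdisj : Disjoint S T) (hST : ∀ x ∈ S, ∀ y ∈ T, ¬ G.Adj x y) :
    (branchesIn B S).ncard < s ∨ (branchesIn B T).ncard < s := by
  by_contra! h
  obtain ⟨w, hw, w', hw', hadj⟩ := hH (hB.disjoint_branchesIn hdisj) h.1 h.2
  obtain ⟨x, hx, y, hy, hxy⟩ := hB.exists_adj hadj
  exact hST x (hw hx) y (hw' hy) hxy

variable {level : V → ℕ}

lemma not_adj_of_level (hlevel : ∀ x y, G.Adj x y → level x ≤ level y + 1) (k : ℕ) :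
    ∀ x ∈ level ⁻¹' Set.Ioi k, ∀ y ∈ level ⁻¹' Set.Iio k, ¬ G.Adj x y := by
  intro x hx y hy hxy
  have := hlevel x y hxy
  simp only [Set.mem_preimage, Set.mem_Ioi, Set.mem_Iio] at hx hy
  omega

lemma IsMinorModel.card_le_of_level [Finite V] [Finite W] (hB : IsMinorModel H G B)
    (hlevel : ∀ x y, G.Adj x y → level x ≤ level y + 1) (k : ℕ) :
    Nat.card W ≤ (branchesIn B (level ⁻¹' Set.Ioi k)).ncard +
      (branchesIn B (level ⁻¹' Set.Iio k)).ncard + (level ⁻¹' {k}).ncard := by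
  have hcompl : (level ⁻¹' Set.Ioi k ∪ level ⁻¹' Set.Iio k)ᶜ = level ⁻¹' {k} := by
    rw [← Set.preimage_union, ← Set.preimage_compl, Set.union_comm, Set.Iio_union_Ioi, compl_compl]
  exact hcompl ▸ hB.card_le_of_separator (not_adj_of_level hlevel k)

/-- Fewer than `s` branch sets lie on one side of each layer. If the small side were above for
layer `k + 1` and below for layer `k`, too few branch sets would be left. -/
lemma IsMinorModel.le_ncard_branchesIn_Ioi [Finite V] (hB : IsMinorModel H G B)
    (hlevel : ∀ x y, G.Adj x y → level x ≤ level y + 1)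
    (hlayer : ∀ k, (level ⁻¹' {k}).ncard ≤ s) (hs : 0 < s) (hW : 4 * s ≤ Nat.card W)
    (hH : IsJoined H s) (k : ℕ) : s ≤ (branchesIn B (level ⁻¹' Set.Ioi k)).ncard := by
  have : Finite W := Nat.finite_of_card_ne_zero (by omega)
  have hcard k := (hB.card_le_of_level hlevel k).trans (Nat.add_le_add_left (hlayer k) _)
  have hlt k := hB.ncard_branchesIn_lt_or hH
    (Set.Ioi_disjoint_Iio_same.preimage level) (not_adj_of_level hlevel k)
  induction k with
  | zero =>
    have hempty : branchesIn B (level ⁻¹' Set.Iio 0) = ∅ := by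
      rw [← hB.branchesIn_empty, ← bot_eq_zero, Set.Iio_bot, Set.preimage_empty]
    have := hcard 0
    rw [hempty, Set.ncard_empty] at this
    omega
  | succ k ih =>
    have hdisj : Disjoint (branchesIn B (level ⁻¹' Set.Ioi k))
        (branchesIn B (level ⁻¹' Set.Iio (k + 1))) :=
      hB.disjoint_branchesIn <| Disjoint.preimage level <|
        Set.disjoint_left.2 fun _ hlo hhi => (Nat.lt_succ_iff.1 hhi).not_gt hlo
    have hle := Set.ncard_le_card (branchesIn B (level ⁻¹' Set.Ioi k) ∪
        branchesIn B (level ⁻¹' Set.Iio (k + 1)))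
    rw [Set.ncard_union_eq hdisj] at hle
    have := hcard k
    have := hcard (k + 1)
    have := hlt k
    have := hlt (k + 1)
    omega

lemma not_isMinorModel_of_level [Finite V]
    (hlevel : ∀ x y, G.Adj x y → level x ≤ level y + 1)
    (hlayer : ∀ k, (level ⁻¹' {k}).ncard ≤ s) (hs : 0 < s) (hW : 4 * s ≤ Nat.card W)
    (hH : IsJoined H s) : ¬ IsMinorModel H G B := by
  intro hB
  obtain ⟨k, hk⟩ := (Set.finite_range level).bddAbove
  have hempty : level ⁻¹' Set.Ioi k = ∅ :=
    Set.eq_empty_of_forall_notMem fun x hx => (hk (Set.mem_range_self x)).not_gt hx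
  have hle := hB.le_ncard_branchesIn_Ioi hlevel hlayer hs hW hH k
  rw [hempty, hB.branchesIn_empty, Set.ncard_empty] at hle
  exact hs.not_ge hle

end Separator

section JoinedGraph

variable {V κ : Type*}

lemma card_piFinset_ite {α β : Type*} [Fintype α] [DecidableEq α] [Fintype β] (A : Finset α)
    (B : Finset β) :
    (Fintype.piFinset fun a => if a ∈ A then B else Finset.univ).card =
      B.card ^ A.card * Fintype.card β ^ (Fintype.card α - A.card) := by
  rw [Fintype.card_piFinset, ← Finset.card_compl, ← Finset.card_univ, ← Finset.prod_const,
    ← Finset.prod_const, ← Finset.prod_mul_prod_compl A]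
  congr 1
  · exact Finset.prod_congr rfl fun a ha => by rw [if_pos ha]
  · exact Finset.prod_congr rfl fun a ha => by rw [if_neg (Finset.mem_compl.1 ha)]

lemma card_le_of_forall_avoiding [Fintype V] [Fintype κ] [DecidableEq V] [DecidableEq κ] {s : ℕ}
    (h : ∀ f : V → κ → V, ∃ A B : Finset V, A.card = s ∧ B.card = s ∧ ∀ a ∈ A, ∀ i, f a i ∉ B) :
    Fintype.card (V → κ → V) ≤ 2 ^ (2 * Fintype.card V) *
      ((Fintype.card V - s) ^ (s * Fintype.card κ) *
        Fintype.card V ^ (Fintype.card κ * (Fintype.card V - s))) := by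
  let pairs : Finset (Finset V × Finset V) := {P | P.1.card = s ∧ P.2.card = s}
  let avoiding (P : Finset V × Finset V) : Finset (V → κ → V) :=
    Fintype.piFinset fun a => if a ∈ P.1 then Fintype.piFinset fun _ => P.2ᶜ else Finset.univ
  have hcover : (Finset.univ : Finset (V → κ → V)) ⊆ pairs.biUnion avoiding := by
    intro f _
    obtain ⟨A, B, hA, hB, hf⟩ := h f
    refine Finset.mem_biUnion.2
      ⟨(A, B), by simp [pairs, hA, hB], Fintype.mem_piFinset.2 fun a => ?_⟩
    by_cases ha : a ∈ A
    · simpa [ha] using hf a ha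
    · simp [ha]
  have hcard_avoiding : ∀ P ∈ pairs, (avoiding P).card =
      (Fintype.card V - s) ^ (s * Fintype.card κ) *
        Fintype.card V ^ (Fintype.card κ * (Fintype.card V - s)) := by
    intro P hP
    obtain ⟨hA, hB⟩ := (Finset.mem_filter.1 hP).2
    simp only [avoiding]
    rw [card_piFinset_ite, Fintype.card_piFinset, Finset.prod_const, Finset.card_compl,
      Finset.card_univ, hA, hB, Fintype.card_fun, ← pow_mul, ← pow_mul, mul_comm s]
  have hcard_pairs : pairs.card ≤ 2 ^ (2 * Fintype.card V) := by
    refine (Finset.card_le_univ _).trans_eq ?_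
    rw [Fintype.card_prod, Fintype.card_finset, ← pow_add, two_mul]
  exact (Finset.card_le_card hcover).trans <| (Finset.card_biUnion_le_card_mul _ _ _
    fun P hP => (hcard_avoiding P hP).le).trans (Nat.mul_le_mul_right _ hcard_pairs)

lemma exists_joining_function [Fintype V] [Fintype κ] {s : ℕ}
    (hcount : 2 ^ (2 * Fintype.card V) * (Fintype.card V - s) ^ (s * Fintype.card κ) <
      Fintype.card V ^ (s * Fintype.card κ)) :
    ∃ f : V → κ → V, ∀ A B : Finset V, A.card = s → B.card = s → ∃ a ∈ A, ∃ i, f a i ∈ B := by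
  classical
  by_contra! h
  have hpos : 0 < Fintype.card V := Nat.pos_of_ne_zero fun hzero => by simp [hzero] at hcount
  have hs : s ≤ Fintype.card V := by
    obtain ⟨A, -, rfl, -⟩ := h fun v _ => v
    exact Finset.card_le_univ A
  refine lt_irrefl (Fintype.card (V → κ → V)) ?_
  calc Fintype.card (V → κ → V)
      ≤ 2 ^ (2 * Fintype.card V) * ((Fintype.card V - s) ^ (s * Fintype.card κ) *
        Fintype.card V ^ (Fintype.card κ * (Fintype.card V - s))) := card_le_of_forall_avoiding h
    _ = 2 ^ (2 * Fintype.card V) * (Fintype.card V - s) ^ (s * Fintype.card κ) *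
        Fintype.card V ^ (Fintype.card κ * (Fintype.card V - s)) := (mul_assoc _ _ _).symm
    _ < Fintype.card V ^ (s * Fintype.card κ) *
        Fintype.card V ^ (Fintype.card κ * (Fintype.card V - s)) := by gcongr
    _ = Fintype.card (V → κ → V) := by
        rw [Fintype.card_fun, Fintype.card_fun, ← pow_mul, ← pow_add, mul_comm s, ← mul_add,
          Nat.add_sub_cancel' hs]

/-- The graph with an edge between `v` and `f v i` whenever these are different. -/
def arcGraph (f : V → κ → V) : SimpleGraph V := fromRel fun v w => ∃ i, f v i = w

lemma arcGraph_adj {f : V → κ → V} {v w : V} :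
    (arcGraph f).Adj v w ↔ v ≠ w ∧ ((∃ i, f v i = w) ∨ ∃ i, f w i = v) :=
  fromRel_adj _ _ _

lemma arcGraph_adj_apply {f : V → κ → V} {v : V} {i : κ} (h : v ≠ f v i) :
    (arcGraph f).Adj v (f v i) :=
  arcGraph_adj.2 ⟨h, Or.inl ⟨i, rfl⟩⟩

lemma ncard_edgeSet_arcGraph_le [Finite V] [Finite κ] (f : V → κ → V) :
    (arcGraph f).edgeSet.ncard ≤ Nat.card V * Nat.card κ := by
  have hsub : (arcGraph f).edgeSet ⊆ Set.range fun p : V × κ => s(p.1, f p.1 p.2) := by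
    intro e he
    induction e with | _ v w
    obtain ⟨-, ⟨i, rfl⟩ | ⟨i, rfl⟩⟩ := arcGraph_adj.1 ((mem_edgeSet _).1 he)
    · exact ⟨(v, i), rfl⟩
    · exact ⟨(w, i), Sym2.eq_swap⟩
  calc (arcGraph f).edgeSet.ncard
      ≤ (Set.range fun p : V × κ => s(p.1, f p.1 p.2)).ncard := Set.ncard_le_ncard hsub
    _ ≤ (Set.univ : Set (V × κ)).ncard := Set.image_univ ▸ Set.ncard_image_le
    _ = Nat.card V * Nat.card κ := by rw [Set.ncard_univ, Nat.card_prod]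

lemma isJoined_arcGraph [Finite V] {f : V → κ → V} {s : ℕ}
    (hf : ∀ A B : Finset V, A.card = s → B.card = s → ∃ a ∈ A, ∃ i, f a i ∈ B) :
    IsJoined (arcGraph f) s := by
  intro X Y hXY hX hY
  obtain ⟨A, hA, rfl⟩ := Finset.exists_subset_card_eq <|
    (Set.ncard_eq_toFinset_card X) ▸ hX
  obtain ⟨B, hB, hBA⟩ := Finset.exists_subset_card_eq <|
    (Set.ncard_eq_toFinset_card Y) ▸ hY
  obtain ⟨a, ha, i, hi⟩ := hf A B rfl hBA
  have ha' := (Set.Finite.mem_toFinset _).1 (hA ha)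
  have hi' := (Set.Finite.mem_toFinset _).1 (hB hi)
  exact ⟨a, ha', f a i, hi', arcGraph_adj_apply fun heq => hXY.notMem_of_mem_left ha' (heq ▸ hi')⟩

lemma exists_isJoined_graph {s : ℕ} (hs : 0 < s) :
    ∃ H : SimpleGraph (Fin (4 * s)), (∀ v, ¬ H.IsIsolated v) ∧ H.edgeSet.ncard ≤ 84 * s ∧
      IsJoined H s := by
  have hcount : 2 ^ (2 * (4 * s)) * (4 * s - s) ^ (s * 20) < (4 * s) ^ (s * 20) := by
    rw [show 4 * s - s = 3 * s by omega, mul_pow, mul_pow, ← mul_assoc,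
      show 2 * (4 * s) = s * 8 by ring, pow_mul' 2, pow_mul' 3, pow_mul' 4, ← mul_pow]
    gcongr
    norm_num
  obtain ⟨f, hf⟩ := exists_joining_function (V := Fin (4 * s)) (κ := Fin 20) (s := s)
    (by simpa only [Fintype.card_fin] using hcount)
  have rev_ne (v : Fin (4 * s)) : v ≠ v.rev := fun h => by
    have := congrArg Fin.val h
    rw [Fin.val_rev] at this
    omega
  -- The arcs `v → v.rev` only serve to avoid isolated vertices.
  refine ⟨arcGraph fun v i => Option.elim i v.rev (f v), fun v hv => ?_, ?_, ?_⟩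
  · exact hv _ (arcGraph_adj_apply (i := none) (rev_ne v))
  · refine (ncard_edgeSet_arcGraph_le _).trans_eq ?_
    rw [Nat.card_eq_fintype_card, Nat.card_eq_fintype_card, Fintype.card_option, Fintype.card_fin,
      Fintype.card_fin]
    ring
  · refine isJoined_arcGraph fun A B hA hB => ?_
    obtain ⟨a, ha, i, hi⟩ := hf A B hA hB
    exact ⟨a, ha, some i, hi⟩

end JoinedGraph

section NotUniversal

lemma hammingNorm_le_of_adj {d : ℕ} {x y : Fin d → ZMod 2} (h : (hypercube d).Adj x y) :
    hammingNorm x ≤ hammingNorm y + 1 := by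
  have hdist : hammingDist x y = 1 := h
  have htriangle := hammingDist_triangle x y 0
  rw [hammingDist_zero_right, hammingDist_zero_right] at htriangle
  omega

lemma ncard_hammingNorm_fibre_le (d k : ℕ) :
    ((hammingNorm : (Fin d → ZMod 2) → ℕ) ⁻¹' {k}).ncard ≤ d.choose k := by
  have hcard : (Finset.powersetCard k (Finset.univ : Finset (Fin d))).card = d.choose k := by
    rw [Finset.card_powersetCard, Finset.card_univ, Fintype.card_fin]
  rw [← hcard, ← Set.ncard_coe_finset]
  refine Set.ncard_le_ncard_of_injOn (fun x => Finset.univ.filter fun i => x i ≠ 0) ?_ ?_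
  · intro x hx
    exact Finset.mem_coe.2 (Finset.mem_powersetCard.2 ⟨Finset.subset_univ _, hx⟩)
  · intro x _ y _ hxy
    funext i
    have hi : x i ≠ 0 ↔ y i ≠ 0 := by simpa using Finset.ext_iff.1 hxy i
    have eq_of_ne_zero_iff : ∀ a b : ZMod 2, (a ≠ 0 ↔ b ≠ 0) → a = b := by decide
    exact eq_of_ne_zero_iff _ _ hi

lemma not_isMinor_hypercube {d : ℕ} {W : Type*} {H : SimpleGraph W}
    (hW : 4 * d.choose (d / 2) ≤ Nat.card W) (hH : IsJoined H (d.choose (d / 2))) :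
    ¬ H.IsMinor (hypercube d) := by
  intro hminor
  obtain ⟨B, hB⟩ := exists_isMinorModel hminor
  exact not_isMinorModel_of_level (fun _ _ => hammingNorm_le_of_adj)
    (fun k => (ncard_hammingNorm_fibre_le d k).trans (Nat.choose_le_middle k d))
    (Nat.choose_pos (Nat.div_le_self d 2)) hW hH hB

lemma sq_centralBinom_mul_le (n : ℕ) : n.centralBinom ^ 2 * (2 * n + 1) ≤ 4 ^ (2 * n) := by
  induction n with
  | zero => simp
  | succ n ih =>
    refine le_of_mul_le_mul_left ?_ (pow_pos n.succ_pos 2)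
    calc (n + 1) ^ 2 * ((n + 1).centralBinom ^ 2 * (2 * (n + 1) + 1))
        = ((n + 1) * (n + 1).centralBinom) ^ 2 * (2 * n + 3) := by ring
      _ = (n.centralBinom ^ 2 * (2 * n + 1)) * (4 * ((2 * n + 1) * (2 * n + 3))) := by
          rw [Nat.succ_mul_centralBinom_succ]; ring
      _ ≤ 4 ^ (2 * n) * (16 * (n + 1) ^ 2) := Nat.mul_le_mul ih (by nlinarith)
      _ = (n + 1) ^ 2 * 4 ^ (2 * (n + 1)) := by ring

lemma sq_choose_middle_mul_le (d : ℕ) : d.choose (d / 2) ^ 2 * d ≤ 4 ^ d := by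
  obtain ⟨n, rfl | rfl⟩ := Nat.even_or_odd' d
  · rw [Nat.mul_div_cancel_left n two_pos]
    exact (Nat.mul_le_mul_left _ (Nat.le_succ _)).trans (sq_centralBinom_mul_le n)
  · have hcentral : (n + 1).centralBinom = 2 * (2 * n + 1).choose n := by
      rw [Nat.centralBinom_eq_two_mul_choose, show 2 * (n + 1) = 2 * n + 1 + 1 by ring,
        Nat.choose_succ_succ, Nat.choose_symm_half, ← two_mul]
    have hbound := sq_centralBinom_mul_le (n + 1)
    rw [hcentral, show 2 * (n + 1) = 2 * n + 1 + 1 by ring, pow_succ 4 (2 * n + 1)] at hbound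
    rw [show (2 * n + 1) / 2 = n by omega]
    nlinarith [sq_nonneg ((2 * n + 1).choose n)]

lemma choose_middle_le_div_sqrt {d : ℕ} (hd : d ≠ 0) :
    (d.choose (d / 2) : ℝ) ≤ 2 ^ d / Real.sqrt d := by
  have hsqrt : 0 < Real.sqrt d := Real.sqrt_pos.2 (by exact_mod_cast hd.bot_lt)
  rw [le_div_iff₀ hsqrt, ← sq_le_sq₀ (by positivity) (by positivity), mul_pow,
    Real.sq_sqrt (Nat.cast_nonneg d), pow_right_comm, show (2 : ℝ) ^ 2 = 4 by norm_num]
  exact_mod_cast sq_choose_middle_mul_le d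

theorem not_isMinorUniversal_hypercube {d : ℕ} (hd : d ≠ 0) :
    ¬ (hypercube d).IsMinorUniversal (84 * 2 ^ d / Real.sqrt d) := by
  intro huniv
  obtain ⟨H, hisolated, hcard, hjoined⟩ :=
    exists_isJoined_graph (Nat.choose_pos (Nat.div_le_self d 2))
  refine not_isMinor_hypercube (Nat.card_fin _).ge hjoined (huniv _ H hisolated ?_)
  calc (H.edgeSet.ncard : ℝ) ≤ 84 * d.choose (d / 2) := by exact_mod_cast hcard
    _ ≤ 84 * (2 ^ d / Real.sqrt d) := by gcongr; exact choose_middle_le_div_sqrt hd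
    _ = 84 * 2 ^ d / Real.sqrt d := by ring

end NotUniversal

section HypercubeProducts

variable {V V' W W' : Type*} {G : SimpleGraph V} {G' : SimpleGraph V'} {H : SimpleGraph W}
  {H' : SimpleGraph W'} {m n d : ℕ}

lemma isContained_boxProd (hG : G ⊑ G') (hH : H ⊑ H') : (G □ H) ⊑ (G' □ H') := by
  obtain ⟨f⟩ := hG
  obtain ⟨g⟩ := hH
  refine ⟨⟨⟨Prod.map f g, fun {x y} hxy => ?_⟩, f.injective.prodMap g.injective⟩⟩
  rw [boxProd_adj] at hxy ⊢
  exact hxy.imp (.imp f.toHom.map_adj (congrArg g)) (.imp g.toHom.map_adj (congrArg f))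

lemma hypercube_adj_of_ne {x y : Fin d → ZMod 2} (i : Fin d) (hne : x ≠ y)
    (h : ∀ j, j ≠ i → x j = y j) : (hypercube d).Adj x y := by
  obtain ⟨j, hj⟩ := Function.ne_iff.1 hne
  obtain rfl : j = i := by_contra fun hji => hj (h j hji)
  refine Finset.card_eq_one.2 ⟨j, Finset.eq_singleton_iff_unique_mem.2 ⟨by simpa using hj, ?_⟩⟩
  exact fun l hl => by_contra fun hlj => (Finset.mem_filter.1 hl).2 (h l hlj)

lemma hammingDist_append (x x' : Fin m → ZMod 2) (y y' : Fin n → ZMod 2) :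
    hammingDist (Fin.append x y) (Fin.append x' y') = hammingDist x x' + hammingDist y y' := by
  simp only [hammingDist, Finset.card_filter, Fin.sum_univ_add, Fin.append_left, Fin.append_right]

lemma hypercube_boxProd_isContained (m n : ℕ) :
    (hypercube m □ hypercube n) ⊑ hypercube (m + n) := by
  refine ⟨⟨⟨Fin.appendEquiv m n, fun {x y} hxy => ?_⟩, (Fin.appendEquiv m n).injective⟩⟩
  change hammingDist (Fin.append x.1 x.2) (Fin.append y.1 y.2) = 1
  rw [hammingDist_append]
  rcases hxy with ⟨hadj, heq⟩ | ⟨hadj, heq⟩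
  · rw [heq, hammingDist_self]
    exact hadj
  · rw [heq, hammingDist_self, zero_add]
    exact hadj

lemma top_isContained_hypercube_one : (⊤ : SimpleGraph (ZMod 2)) ⊑ hypercube 1 :=
  ⟨⟨⟨fun a _ => a, fun h => hypercube_adj_of_ne 0 (fun heq => h.ne (congrFun heq 0))
    fun j hj => absurd (Subsingleton.elim j 0) hj⟩, fun _ _ h => congrFun h 0⟩⟩

lemma pathGraph_isContained (hmn : m ≤ n) : pathGraph m ⊑ pathGraph n :=
  ⟨⟨⟨Fin.castLE hmn, by simp [pathGraph_adj]⟩, Fin.castLE_injective hmn⟩⟩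

lemma pathGraph_mul_two_isContained (m : ℕ) :
    pathGraph (m * 2) ⊑ (pathGraph m □ (⊤ : SimpleGraph (ZMod 2))) := by
  -- The path zigzags through the ladder: up, right, down, right, up, ...
  let f (i : Fin (m * 2)) : Fin m × ZMod 2 := (⟨i / 2, by omega⟩, ((i + 1) / 2 : ℕ))
  have adj_of_succ {i j : Fin (m * 2)} (h : (i : ℕ) + 1 = j) :
      (pathGraph m □ (⊤ : SimpleGraph (ZMod 2))).Adj (f i) (f j) := by
    simp only [f, boxProd_adj, pathGraph_adj, top_adj, ne_eq, ZMod.natCast_eq_natCast_iff',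
      Fin.mk.injEq]
    omega
  refine ⟨⟨⟨f, fun h => ?_⟩, fun i j h => Fin.ext ?_⟩⟩
  · exact (pathGraph_adj.1 h).elim adj_of_succ fun h => (adj_of_succ h).symm
  · obtain ⟨hfst, hsnd⟩ := Prod.mk.inj h
    have := Fin.mk.inj hfst
    have := (ZMod.natCast_eq_natCast_iff' _ _ 2).1 hsnd
    omega

lemma pathGraph_two_pow_isContained_hypercube (n : ℕ) : pathGraph (2 ^ n) ⊑ hypercube n := by
  induction n with
  | zero =>
    have : Subsingleton (Fin (2 ^ 0)) := inferInstanceAs (Subsingleton (Fin 1))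
    exact ⟨⟨⟨fun _ => 0, fun h => absurd (Subsingleton.elim _ _) h.ne⟩,
      injective_of_subsingleton _⟩⟩
  | succ n ih =>
    exact (pathGraph_mul_two_isContained (2 ^ n)).trans
      ((isContained_boxProd ih top_isContained_hypercube_one).trans
        (hypercube_boxProd_isContained n 1))

lemma connected_induce_pathGraph {I : Set (Fin n)} (hI : I.OrdConnected) (hne : I.Nonempty) :
    ((pathGraph n).induce I).Connected := by
  have := hne.to_subtype
  have covBy_coe {a b : I} : a ⋖ b → (a : Fin n) ⋖ b :=
    (Set.OrdConnected.apply_covBy_apply_iff (OrderEmbedding.subtype (· ∈ I))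
      (by simpa using hI)).2
  have hle : hasse I ≤ (pathGraph n).induce I := fun a b hab => hab.imp covBy_coe covBy_coe
  exact ⟨(hasse_preconnected_of_succ I).mono hle⟩

end HypercubeProducts

section BenesNetwork

open Equiv.Perm

variable {Ω ι : Type*}

lemma exists_two_coloring_of_involutive {f : Ω → Ω} (hf : Involutive f) (hne : ∀ x, f x ≠ x) :
    ∃ c : Ω → ZMod 2, ∀ x, c (f x) ≠ c x := by
  classical
  let _ : LinearOrder Ω := linearOrderOfSTO WellOrderingRel
  refine ⟨fun x => if x < f x then 1 else 0, fun x => ?_⟩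
  rcases (hne x).lt_or_gt with h | h <;> simp [hf x, h, h.not_gt]

lemma semiconjBy_mul_inv {s t : Equiv.Perm Ω} (hs : Involutive s) (ht : Involutive t) :
    SemiconjBy s (s * t) (s * t)⁻¹ := by
  have hs_inv : s⁻¹ = s := Equiv.ext fun x => Equiv.Perm.inv_eq_iff_eq.2 (hs x).symm
  have ht_inv : t⁻¹ = t := Equiv.ext fun x => Equiv.Perm.inv_eq_iff_eq.2 (ht x).symm
  ext x
  simp [hs_inv, ht_inv, hs _]

lemma not_sameCycle_mul_apply {s t : Equiv.Perm Ω} (hs : Involutive s) (ht : Involutive t)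
    (hs_ne : ∀ x, s x ≠ x) (ht_ne : ∀ x, t x ≠ x) (x : Ω) : ¬ (s * t).SameCycle x (s x) := by
  rintro ⟨n, hn⟩
  have apply_zpow (m : ℤ) : s (((s * t) ^ m) x) = ((s * t) ^ (n - m)) x := by
    have := congrArg (· x) ((semiconjBy_mul_inv hs ht).zpow_right m).eq
    rw [sub_eq_neg_add, zpow_add, Equiv.Perm.mul_apply, hn, zpow_neg, ← inv_zpow]
    exact this
  obtain ⟨m, rfl | rfl⟩ := Int.even_or_odd' n
  · refine hs_ne (((s * t) ^ m) x) ?_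
    rw [apply_zpow]
    congr 2
    ring
  · refine ht_ne (((s * t) ^ m) x) (s.injective ?_)
    rw [apply_zpow, ← Equiv.Perm.mul_apply, ← Equiv.Perm.mul_apply, ← zpow_one_add]
    congr 2
    ring

-- Both `s` and `t` act on the cycles of `s * t`; they act in the same way, without fixed cycles.
lemma exists_common_two_coloring {s t : Equiv.Perm Ω} (hs : Involutive s) (ht : Involutive t)
    (hs_ne : ∀ x, s x ≠ x) (ht_ne : ∀ x, t x ≠ x) :
    ∃ c : Ω → ZMod 2, (∀ x, c (s x) ≠ c x) ∧ ∀ x, c (t x) ≠ c x := by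
  have sameCycle_map (x y : Ω) (h : (s * t).SameCycle x y) : (s * t).SameCycle (s x) (s y) := by
    have := h.conj (g := s)
    rwa [(semiconjBy_mul_inv hs ht).eq, mul_inv_cancel_right, sameCycle_inv] at this
  let mk : Ω → Quotient (SameCycle.setoid (s * t)) := Quotient.mk _
  obtain ⟨c, hc⟩ := exists_two_coloring_of_involutive
    (f := Quotient.map (sa := SameCycle.setoid (s * t)) (sb := SameCycle.setoid (s * t)) s
      sameCycle_map)
    (by rintro ⟨x⟩; exact congrArg mk (hs x))
    (by
      rintro ⟨x⟩ h
      exact not_sameCycle_mul_apply hs ht hs_ne ht_ne x (Quotient.exact h).symm)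
  have mk_t (x : Ω) : mk (t x) = mk (s x) := by
    refine Quotient.sound ⟨1, ?_⟩
    rw [zpow_one, Equiv.Perm.mul_apply, ht]
  refine ⟨fun x => c (mk x), fun x => hc (mk x), fun x => ?_⟩
  simp only [mk_t]
  exact hc (mk x)

/-- A permutation of a cube is directional along `i` if it changes no coordinate other than the
`i`-th one. -/
def IsDirectional (i : ι) (σ : Equiv.Perm (ι → ZMod 2)) : Prop :=
  ∀ x j, j ≠ i → σ x j = x j

lemma IsDirectional.inv {i : ι} {σ : Equiv.Perm (ι → ZMod 2)} (hσ : IsDirectional i σ) :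
    IsDirectional i σ⁻¹ := fun x j hj => by
  simpa using (hσ (σ⁻¹ x) j hj).symm

variable [Finite ι]

lemma exists_perm_eq_update [DecidableEq ι] {i : ι} {c : (ι → ZMod 2) → ZMod 2}
    (hc : ∀ x, c (x + Pi.single i 1) ≠ c x) :
    ∃ σ : Equiv.Perm (ι → ZMod 2), IsDirectional i σ ∧ ∀ x, σ x = update x i (c x) := by
  have injective_update : Injective fun x => update x i (c x) := by
    intro x y h
    have hi : c x = c y := by simpa using congrFun h i
    have hj (j : ι) (hj : j ≠ i) : x j = y j := by simpa [hj] using congrFun h j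
    have eq_add_one : ∀ a b : ZMod 2, a ≠ b → b = a + 1 := by decide
    by_contra hxy
    refine hc x (hi ▸ congrArg c (funext fun j => ?_))
    obtain rfl | hji := eq_or_ne j i
    · rw [eq_add_one (x j) (y j) fun he => hxy (funext fun l => ?_)]
      · simp
      · obtain rfl | hl := eq_or_ne l j
        exacts [he, hj l hl]
    · simp [hji, hj j hji]
  refine ⟨.ofBijective _ (Finite.injective_iff_bijective.1 injective_update), ?_, fun x => rfl⟩
  exact fun x j hj => update_of_ne hj _ _

lemma exists_isDirectional_mul_mul_eq (i : ι) (π : Equiv.Perm (ι → ZMod 2)) :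
    ∃ a π' b : Equiv.Perm (ι → ZMod 2), IsDirectional i a ∧ IsDirectional i b ∧ a * π' * b = π ∧
      (∀ x, π' x i = x i) ∧ ∀ j, (∀ x, π x j = x j) → ∀ x, π' x j = x j := by
  classical
  let s := Equiv.addRight (Pi.single i 1 : ι → ZMod 2)
  have hs : Involutive s := fun x => by
    simp [s, add_assoc, ← Pi.single_add, CharTwo.add_self_eq_zero]
  have hs_ne (x) : s x ≠ x := by simp [s]
  obtain ⟨c, hc, hcπ⟩ := exists_common_two_coloring (t := π⁻¹ * s * π) hs
    (fun x => by simp [hs _]) hs_ne (fun x h => hs_ne (π x) (Equiv.Perm.inv_eq_iff_eq.1 h))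
  obtain ⟨b, hb, hb_apply⟩ := exists_perm_eq_update hc
  obtain ⟨a, ha, ha_apply⟩ := exists_perm_eq_update (i := i) (c := fun y => c (π⁻¹ y)) fun y => by
    simpa [s] using hcπ (π⁻¹ y)
  have apply_b (x) : (a * π * b⁻¹) (b x) = update (π x) i (c x) := by simp [ha_apply]
  refine ⟨a⁻¹, a * π * b⁻¹, b, ha.inv, hb, by group, fun x => ?_, fun j hj x => ?_⟩
  · obtain ⟨x, rfl⟩ := b.surjective x
    rw [apply_b, hb_apply, update_self, update_self]
  · obtain ⟨x, rfl⟩ := b.surjective x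
    rw [apply_b, hb_apply]
    obtain rfl | hji := eq_or_ne j i
    · rw [update_self, update_self]
    · rw [update_of_ne hji, update_of_ne hji, hj]

lemma exists_list_isDirectional_prod_eq (s : Finset ι) {π : Equiv.Perm (ι → ZMod 2)}
    (hπ : ∀ j ∉ s, ∀ x, π x j = x j) :
    ∃ L : List (Equiv.Perm (ι → ZMod 2)), L.length = 2 * s.card ∧ L.prod = π ∧
      ∀ σ ∈ L, ∃ i, IsDirectional i σ := by
  classical
  induction s using Finset.induction_on generalizing π with
  | empty => exact ⟨[], rfl, Equiv.ext fun x => funext fun j => (hπ j (by simp) x).symm, by simp⟩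
  | insert i s hi ih =>
    obtain ⟨a, π', b, ha, hb, rfl, hπ'i, hπ'⟩ := exists_isDirectional_mul_mul_eq i π
    obtain ⟨L, hlen, rfl, hL⟩ := ih fun j hj => by
      obtain rfl | hji := eq_or_ne j i
      exacts [hπ'i, hπ' j (hπ j (by simp [hji, hj]))]
    refine ⟨a :: (L ++ [b]), ?_, by simp [mul_assoc], ?_⟩
    · simp only [List.length_cons, List.length_append, hlen, List.length_nil,
        Finset.card_insert_of_notMem hi]
      ring
    · simp only [List.mem_cons, List.mem_append, List.not_mem_nil, or_false]
      rintro σ (rfl | hσ | rfl)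
      exacts [⟨i, ha⟩, hL σ hσ, ⟨i, hb⟩]

end BenesNetwork

section Routing

variable {V : Type*} {k l : ℕ}

/-- The graph `G` together with a second copy of `G`, placed on the same vertices by means of the
permutation `π`. -/
def routingGraph (G : SimpleGraph V) (π : Equiv.Perm V) : SimpleGraph V :=
  G ⊔ G.comap π

/-- The four-cycle, with its corners labelled by pairs of bits as in a two-dimensional cube. -/
abbrev fourCycle : SimpleGraph (ZMod 2 × ZMod 2) :=
  ⊤ □ ⊤

/-- The vertices of a cube times a four-cycle used by the strand that enters at `x` and leaves at
`σ x`, where `σ` changes only the `i`-th coordinate. Strands enter at the corner `(p, p)` of the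
four-cycle and leave at the opposite one. They move from `x` to `σ x` at one of the two other
corners, chosen according to `x i`, so that strands entering at different vertices stay disjoint. -/
def strand (i : Fin k) (σ : Equiv.Perm (Fin k → ZMod 2)) (p : ZMod 2) (x : Fin k → ZMod 2) :
    Set ((Fin k → ZMod 2) × ZMod 2 × ZMod 2) :=
  {(x, p, p), (x, p + x i, p + x i + 1)} ∪ {(σ x, p + x i, p + x i + 1), (σ x, p + 1, p + 1)}

variable {i : Fin k} {σ : Equiv.Perm (Fin k → ZMod 2)}

lemma connected_induce_strand (hσ : IsDirectional i σ) (p : ZMod 2) (x : Fin k → ZMod 2) :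
    ((hypercube k □ fourCycle).induce (strand i σ p x)).Connected := by
  have adj_corners : ∀ p e : ZMod 2,
      fourCycle.Adj (p, p) (p + e, p + e + 1) ∧
        fourCycle.Adj (p + e, p + e + 1) (p + 1, p + 1) := by
    simp only [fourCycle, boxProd_adj, top_adj]
    decide
  have connected_entry := induce_pair_connected_of_adj
    (boxProd_adj_right (G := hypercube k) (a := x) |>.2 (adj_corners p (x i)).1)
  have connected_exit := induce_pair_connected_of_adj
    (boxProd_adj_right (G := hypercube k) (a := σ x) |>.2 (adj_corners p (x i)).2)
  by_cases hx : x = σ x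
  · exact induce_union_connected connected_entry.preconnected connected_exit.preconnected
      ⟨_, Or.inr rfl, Or.inl (by rw [← hx])⟩
  · exact connected_induce_union connected_entry.preconnected connected_exit.preconnected
      (Or.inr rfl) (Or.inl rfl)
      (boxProd_adj_left.2 (hypercube_adj_of_ne i hx fun j hj => (hσ x j hj).symm))

lemma eq_of_mem_strand (hσ : IsDirectional i σ) {p : ZMod 2} {x x' : Fin k → ZMod 2}
    {z : (Fin k → ZMod 2) × ZMod 2 × ZMod 2} (hz : z ∈ strand i σ p x)
    (hz' : z ∈ strand i σ p x') : x = x' := by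
  let entry (z : (Fin k → ZMod 2) × ZMod 2 × ZMod 2) : Fin k → ZMod 2 :=
    if z.2.1 ≠ z.2.2 then update z.1 i (z.2.1 - p) else if z.2.1 = p then z.1 else σ.symm z.1
  have update_apply (y : Fin k → ZMod 2) : update (σ y) i (y i) = y := by
    refine funext fun j => ?_
    obtain rfl | hj := eq_or_ne j i
    · exact update_self ..
    · rw [update_of_ne hj, hσ y j hj]
  have entry_eq {y : Fin k → ZMod 2} (hy : z ∈ strand i σ p y) : entry z = y := by
    rcases hy with (rfl | rfl) | (rfl | rfl) <;> simp [entry, update_apply]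
  exact (entry_eq hz).symm.trans (entry_eq hz')

variable {L : List (Equiv.Perm (Fin k → ZMod 2))} {coord : Fin L.length → Fin k}

/-- The part in layer `j` of the route from `x` to `L.prod x`, where `L[j]` is directional along
`coord j`. The last entry of `L` acts first, so that routes run from the last layer to layer `0`;
strands enter and leave at alternating corners of the four-cycle. -/
def route (coord : Fin L.length → Fin k) (x : Fin k → ZMod 2) (j : Fin L.length) :
    Set (((Fin k → ZMod 2) × ZMod 2 × ZMod 2) × Fin L.length) :=
  (fun z => (z, j)) '' strand (coord j) L[j] (j : ℕ) ((L.drop (j + 1)).prod x)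

lemma entry_mem_route (x : Fin k → ZMod 2) (j : Fin L.length) :
    (((L.drop (j + 1)).prod x, ((j : ℕ) : ZMod 2), ((j : ℕ) : ZMod 2)), j) ∈ route coord x j :=
  ⟨_, Or.inl (Or.inl rfl), rfl⟩

lemma exit_mem_route (x : Fin k → ZMod 2) (j : Fin L.length) :
    (((L.drop j).prod x, ((j : ℕ) : ZMod 2) + 1, ((j : ℕ) : ZMod 2) + 1), j) ∈ route coord x j := by
  rw [List.drop_eq_getElem_cons j.2, List.prod_cons, Equiv.Perm.mul_apply]
  exact ⟨_, Or.inr (Or.inr rfl), rfl⟩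

lemma connected_induce_iUnion_route (hne : L ≠ []) (hL : ∀ j, IsDirectional (coord j) L[j])
    (x : Fin k → ZMod 2) :
    (((hypercube k □ fourCycle) □ pathGraph L.length).induce (⋃ j, route coord x j)).Connected := by
  have : Nonempty (Fin L.length) := ⟨⟨0, List.length_pos_iff.2 hne⟩⟩
  have connected_route (j : Fin L.length) :
      (((hypercube k □ fourCycle) □ pathGraph L.length).induce (route coord x j)).Connected :=
    connected_induce_image (connected_induce_strand (hL j) _ _) fun _ _ h =>
      Or.inr (boxProd_adj_left.2 h)
  have connected_union {j j' : Fin L.length} (h : (j : ℕ) + 1 = j') :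
      (((hypercube k □ fourCycle) □ pathGraph L.length).induce
        (route coord x j ∪ route coord x j')).Connected := by
    have hexit := exit_mem_route (coord := coord) x j'
    rw [← h, Nat.cast_succ, add_assoc, CharTwo.add_self_eq_zero, add_zero] at hexit
    exact connected_induce_union (connected_route j).preconnected (connected_route j').preconnected
      (entry_mem_route x j) hexit (boxProd_adj_right.2 (pathGraph_adj.2 (Or.inl h)))
  refine connected_induce_iUnion ⟨pathGraph_preconnected _⟩ connected_route fun j j' h => ?_
  rcases pathGraph_adj.1 h with h | h
  · exact connected_union h
  · rw [Set.union_comm]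
    exact connected_union h

lemma isMinorModel_iUnion_route (hne : L ≠ []) (hL : ∀ j, IsDirectional (coord j) L[j]) :
    IsMinorModel (routingGraph (hypercube k) L.prod)
      ((hypercube k □ fourCycle) □ pathGraph L.length) fun x => ⋃ j, route coord x j where
  connected := connected_induce_iUnion_route hne hL
  disjoint := pairwise_disjoint_of_eq_of_mem fun x x' z hz hz' => by
    obtain ⟨j, y, hy, rfl⟩ := Set.mem_iUnion.1 hz
    obtain ⟨j', y', hy', heq⟩ := Set.mem_iUnion.1 hz'
    obtain ⟨rfl, rfl⟩ := Prod.mk.inj heq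
    exact (L.drop _).prod.injective (eq_of_mem_strand (hL _) hy hy')
  exists_adj {x x'} h := by
    have hpos := List.length_pos_iff.2 hne
    rcases h with h | h
    · let last : Fin L.length := ⟨L.length - 1, by omega⟩
      have entry_mem_last (x) := entry_mem_route (coord := coord) x last
      simp only [last, Nat.sub_add_cancel hpos, List.drop_length, List.prod_nil,
        Equiv.Perm.one_apply] at entry_mem_last
      exact ⟨_, Set.mem_iUnion_of_mem last (entry_mem_last x), _,
        Set.mem_iUnion_of_mem last (entry_mem_last x'), boxProd_adj_left.2 (boxProd_adj_left.2 h)⟩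
    · exact ⟨_, Set.mem_iUnion_of_mem ⟨0, hpos⟩ (exit_mem_route x _), _,
        Set.mem_iUnion_of_mem ⟨0, hpos⟩ (exit_mem_route x' _),
        boxProd_adj_left.2 (boxProd_adj_left.2 h)⟩

lemma exists_isMinorModel_routingGraph_hypercube (hk : k ≠ 0) (hl : 2 * k ≤ 2 ^ l)
    (π : Equiv.Perm (Fin k → ZMod 2)) :
    ∃ B, IsMinorModel (routingGraph (hypercube k) π) (hypercube (k + 2 + l)) B := by
  obtain ⟨L, hlen, rfl, hL⟩ := exists_list_isDirectional_prod_eq Finset.univ (π := π) (by simp)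
  rw [Finset.card_univ, Fintype.card_fin] at hlen
  choose coord hcoord using fun j : Fin L.length => hL L[j] (List.getElem_mem _)
  have model := isMinorModel_iUnion_route (List.length_pos_iff.1 (by omega)) hcoord
  have fourCycle_isContained : fourCycle ⊑ hypercube 2 :=
    (isContained_boxProd top_isContained_hypercube_one top_isContained_hypercube_one).trans
      (hypercube_boxProd_isContained 1 1)
  have prod_isContained : (hypercube k □ fourCycle) ⊑ hypercube (k + 2) :=
    (isContained_boxProd .rfl fourCycle_isContained).trans (hypercube_boxProd_isContained k 2)
  have path_isContained : pathGraph L.length ⊑ hypercube l :=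
    (pathGraph_isContained (hlen.trans_le hl)).trans (pathGraph_two_pow_isContained_hypercube l)
  obtain ⟨f⟩ := (isContained_boxProd prod_isContained path_isContained).trans
    (hypercube_boxProd_isContained (k + 2) l)
  exact ⟨_, model.trans (isMinorModel_singleton f)⟩

end Routing

section Darts

variable {V W : Type*} {G : SimpleGraph V}

lemma exists_equiv_dart_ordConnected [Finite W] (H : SimpleGraph W) :
    ∃ f : Fin (2 * H.edgeSet.ncard) ≃ H.Dart, ∀ w, {a | (f a).fst = w}.OrdConnected := by
  classical
  have := Fintype.ofFinite W
  let _ : LinearOrder W := linearOrderOfSTO WellOrderingRel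
  let _ : LinearOrder H.Dart := LinearOrder.lift' (fun δ : H.Dart => toLex (δ.fst, δ.snd))
    fun δ δ' h => Dart.ext _ _ (toLex.injective h)
  have hcard : Fintype.card H.Dart = 2 * H.edgeSet.ncard := by
    rw [H.dart_card_eq_twice_card_edges, Set.ncard_eq_toFinset_card', edgeFinset]
  let f := Fintype.orderIsoFinOfCardEq H.Dart hcard
  have monotone_fst : Monotone fun a => (f a).fst := fun a b hab =>
    (Prod.Lex.le_iff.1 (f.monotone hab)).elim le_of_lt fun h => h.1.le
  exact ⟨f.toEquiv, fun w => Set.ordConnected_singleton.preimage_mono monotone_fst⟩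

lemma exists_dart_injective_hypercube_adj [Finite W] {H : SimpleGraph W}
    (hk : H.edgeSet.ncard ≤ 2 ^ k) :
    ∃ v : H.Dart → Fin (k + 1) → ZMod 2, Injective v ∧
      ∀ δ, (hypercube (k + 1)).Adj (v δ) (v δ.symm) := by
  classical
  have := Fintype.ofFinite W
  obtain ⟨c, hc⟩ := exists_two_coloring_of_involutive (f := Dart.symm (G := H))
    Dart.symm_involutive Dart.symm_ne
  obtain ⟨e⟩ : Nonempty (H.edgeSet ↪ (Fin k → ZMod 2)) :=
    Embedding.nonempty_of_card_le (by
      simpa only [← Nat.card_eq_fintype_card (α := H.edgeSet), Nat.card_coe_set_eq,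
        Fintype.card_fun, ZMod.card, Fintype.card_fin] using hk)
  let v (δ : H.Dart) : Fin (k + 1) → ZMod 2 := Fin.cons (c δ) (e ⟨δ.edge, δ.edge_mem⟩)
  refine ⟨v, fun δ δ' h => ?_, fun δ => hypercube_adj_of_ne 0 (fun h => ?_) fun j hj => ?_⟩
  · obtain ⟨hcolor, hedge⟩ := Fin.cons_inj.1 h
    refine (dart_edge_eq_iff δ δ').1 (congrArg Subtype.val (e.injective hedge)) |>.resolve_right ?_
    rintro rfl
    exact hc δ' hcolor
  · exact hc δ (Fin.cons_inj.1 h).1.symm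
  · obtain ⟨j, rfl⟩ := Fin.exists_succ_eq.2 hj
    simp only [v, Fin.cons_succ, Dart.edge_symm]

lemma exists_perm_apply_eq {D : Type*} [Finite V] {u v : D → V} (hu : Injective u)
    (hv : Injective v) : ∃ π : Equiv.Perm V, ∀ a, π (u a) = v a := by
  classical
  have := Fintype.ofFinite V
  let e : Set.range u ≃ Set.range v := (Equiv.ofInjective u hu).symm.trans (Equiv.ofInjective v hv)
  refine ⟨e.extendSubtype, fun a => ?_⟩
  rw [e.extendSubtype_apply_of_mem _ ⟨a, rfl⟩]
  simp [e]

lemma exists_isMinorModel_routingGraph [Finite V] [Finite W] {H : SimpleGraph W}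
    (hiso : ∀ w, ¬ H.IsIsolated w) (hpath : pathGraph (2 * H.edgeSet.ncard) ⊑ G)
    {v : H.Dart → V} (hv : Injective v) (hadj : ∀ δ, G.Adj (v δ) (v δ.symm)) :
    ∃ π B, IsMinorModel H (routingGraph G π) B := by
  obtain ⟨u⟩ := hpath
  obtain ⟨f, hf⟩ := exists_equiv_dart_ordConnected H
  obtain ⟨π, hπ⟩ := exists_perm_apply_eq (u.injective.comp f.symm.injective) hv
  refine ⟨π, fun w => u '' {a | (f a).fst = w}, fun w => ?_,
    pairwise_disjoint_of_eq_of_mem ?_, fun {w w'} h => ?_⟩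
  · obtain ⟨w', hww'⟩ := not_forall_not.1 (hiso w)
    exact connected_induce_image
      (connected_induce_pathGraph (hf w) ⟨f.symm ⟨(w, w'), hww'⟩, by simp⟩)
      fun _ _ h => Or.inr (Or.inl (u.toHom.map_adj h))
  · rintro w w' _ ⟨a, rfl, rfl⟩ ⟨b, rfl, hba⟩
    rw [u.injective hba]
  · let δ : H.Dart := ⟨(w, w'), h⟩
    refine ⟨_, ⟨f.symm δ, by simp [δ], rfl⟩, _, ⟨f.symm δ.symm, by simp [δ], rfl⟩, Or.inr ?_⟩
    have hπδ := hadj δ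
    rwa [← hπ δ, ← hπ δ.symm] at hπδ

end Darts

section Universality

variable {W : Type*} [Finite W] {H : SimpleGraph W}

lemma isMinor_hypercube {k l : ℕ} (hiso : ∀ w, ¬ H.IsIsolated w) (hk : H.edgeSet.ncard ≤ 2 ^ k)
    (hl : 2 * (k + 1) ≤ 2 ^ l) : H.IsMinor (hypercube (k + 1 + 2 + l)) := by
  obtain ⟨v, hv, hadj⟩ := exists_dart_injective_hypercube_adj hk
  have hpath : pathGraph (2 * H.edgeSet.ncard) ⊑ hypercube (k + 1) :=
    (pathGraph_isContained (by rw [pow_succ']; gcongr)).trans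
      (pathGraph_two_pow_isContained_hypercube (k + 1))
  obtain ⟨π, B, hB⟩ := exists_isMinorModel_routingGraph hiso hpath hv hadj
  obtain ⟨C, hC⟩ := exists_isMinorModel_routingGraph_hypercube k.succ_ne_zero hl π
  exact (hB.trans hC).isMinor

lemma isMinor_hypercube_of_mul_le {d : ℕ} (hd : d ≠ 0) (hiso : ∀ w, ¬ H.IsIsolated w)
    (hpos : 0 < H.edgeSet.ncard) (hle : H.edgeSet.ncard * (32 * d) ≤ 2 ^ d) :
    H.IsMinor (hypercube d) := by
  obtain ⟨l, hl, hl'⟩ : ∃ l, 2 * d ≤ 2 ^ l ∧ 2 ^ l ≤ 4 * d := by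
    have hlow := Nat.pow_log_le_self 2 hd
    have hhigh := Nat.lt_pow_succ_log_self one_lt_two d
    refine ⟨Nat.log 2 d + 2, ?_, ?_⟩ <;> rw [pow_succ] at * <;> omega
  have hmul : 2 ^ (3 + l) * H.edgeSet.ncard ≤ 2 ^ d := calc
    2 ^ (3 + l) * H.edgeSet.ncard = H.edgeSet.ncard * (8 * 2 ^ l) := by ring
    _ ≤ H.edgeSet.ncard * (8 * (4 * d)) := by gcongr
    _ = H.edgeSet.ncard * (32 * d) := by ring
    _ ≤ 2 ^ d := hle
  have hld : 3 + l ≤ d :=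
    (Nat.pow_le_pow_iff_right one_lt_two).1 ((Nat.le_mul_of_pos_right _ hpos).trans hmul)
  obtain ⟨k, rfl⟩ := Nat.exists_eq_add_of_le' hld
  rw [pow_add 2 k, mul_comm (2 ^ k)] at hmul
  rw [show k + (3 + l) = k + 1 + 2 + l by ring]
  exact isMinor_hypercube hiso (Nat.le_of_mul_le_mul_left hmul (by positivity)) (by omega)

theorem isMinorUniversal_hypercube {d : ℕ} (hd : d ≠ 0) :
    (hypercube d).IsMinorUniversal (1 / 32 * 2 ^ d / d) := by
  intro W _ H hiso hcard
  obtain hzero | hpos := H.edgeSet.ncard.eq_zero_or_pos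
  · rw [Set.ncard_eq_zero, edgeSet_eq_empty] at hzero
    have : IsEmpty W := ⟨fun w => hiso w (hzero ▸ fun _ => id)⟩
    obtain ⟨f⟩ := IsContained.of_isEmpty (A := H) (B := hypercube d)
    exact (isMinorModel_singleton f).isMinor
  · refine isMinor_hypercube_of_mul_le hd hiso hpos ?_
    rw [le_div_iff₀ (by positivity)] at hcard
    have : (H.edgeSet.ncard : ℝ) * (32 * d) ≤ 2 ^ d := by linarith
    exact_mod_cast this

end Universality

end HypercubeMinor

theorem theoremA :
    (∃ c : ℝ, 0 < c ∧ ∀ d : ℕ, 1 ≤ d →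
      (SimpleGraph.hypercube d).IsMinorUniversal (c * 2 ^ d / d)) ∧
    (∃ C : ℝ, 0 < C ∧ ∀ d : ℕ, 1 ≤ d →
      ¬ (SimpleGraph.hypercube d).IsMinorUniversal (C * 2 ^ d / Real.sqrt d)) :=
  ⟨⟨1 / 32, by norm_num, fun _ hd => HypercubeMinor.isMinorUniversal_hypercube (by omega)⟩,
    84, by norm_num, fun _ hd => HypercubeMinor.not_isMinorUniversal_hypercube (by omega)⟩
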